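/- Work in max-plus algebra: tropical addition is $\max$ and tropical multiplication is $+$. The tropical determinant of a square matrix is $\max_\sigma\sum_i a_{i\sigma(i)}$, and the matrix is \emph{tropically regular} if this maximum is attained only once. Identify the projective tropical space $\mathbb{TP}^3=\mathbb R^4/\mathbb R(1,1,1,1)$ with $\mathbb R^3$ by means of representatives with $X_4=0$. Let $A=(a_{ij})\in\mathbb R^{4\times4}$ be a Kleene star, i.e. $a_{ii}=0$ for all $i$ and $A\odot A=A$. Suppose that (1) the columns of $A$ are tropically non-coplanar, i.e. there is no $a\in\mathbb R^4$ such that for every $j$ the maximum $\max_i(a_i+a_{ij})$ is attained at least twice; and (2) every $2\times2$ minor of $A$ involving three or four different indices is tropically regular. Let $\operatorname{span}(A)\subset\mathbb R^3$ be the tropical span of the columns of $A$ (a convex body), let $\underline1,\underline2,\underline3,\underline4$ be the points given by the columns of $A$, and let $\underline{123}$ be the vertex (given by the tropical Cramer rule) of the tropical plane through $\underline1,\underline2,\underline3$. A point of $\operatorname{span}(A)$ is $(5.5.5)$ if exactly three facets meet at it, each of them a pentagon. The point $\underline{123}$ is \emph{$(5.5.5)$ left} (resp. \emph{right}) if it is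 $(5.5.5)$ and, after the translation carrying $\underline{123}$ to the origin, the coordinates of $\underline1,\underline2,\underline3$ in $\mathbb R^3$ are the columns of the first (resp. second) matrix $$\begin{pmatrix}0&-\gamma_2-\delta_2&-\gamma_3-\gamma_2-\delta_2\\-\gamma_1-\gamma_3-\delta_3&0&-\gamma_3-\delta_3\\-\gamma_1-\delta_1&-\gamma_2-\gamma_1-\delta_1&0\end{pmatrix},\qquad\begin{pmatrix}0&-\gamma_2-\gamma_3-\delta_3&-\gamma_3-\delta_3\\-\gamma_1-\delta_1&0&-\gamma_3-\gamma_1-\delta_1\\-\gamma_1-\gamma_2-\delta_2&-\gamma_2-\delta_2&0\end{pmatrix}$$ for some real $\gamma_1,\gamma_2,\gamma_3,\delta_1,\delta_2,\delta_3>0$. The point $\underline4$ is $(5.5.5)$ left (resp. right) if it is $(5.5.5)$ and the above coordinate condition for right (resp. left) holds for $A^t$ in place of $A$. (The antipodal map $x\mapsto-x$ carries $\operatorname{span}(A)$ onto $\operatorname{span}(A^t)$, takes $\underline4$ to $\underline{123}$, and interchanges left and right.) For $p,q\in\mathbb R^4$ put $m_{ij}=\max\{p_i+q_j,p_j+q_i\}$;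 for $\{i,j,k,l\}=\{1,2,3,4\}$ the tropical line through $p,q$ is of type $[ij,kl]$ if $m_{ij}+m_{kl}<m_{ik}+m_{jl}=m_{il}+m_{jk}$. The \emph{type-vector} of $A$ is $(t_1,t_2,t_3)$, where $t_j$ is the number of lines of type $[4j,kl]$, $\{j,k,l\}=\{1,2,3\}$, among the six tropical lines through two columns of $A$. The \emph{polygon-vector} of $\operatorname{span}(A)$ is $(f_3,f_4,f_5,f_6)$, where $f_m$ is the number of facets that are convex $m$-gons, all facets being $m$-gons with $3\le m\le6$. \textbf{Theorem.} If $\underline{123}$ and $\underline4$ are both $(5.5.5)$ left, or both $(5.5.5)$ right, then the type-vector of $A$ is $(2,2,2)$ and the polygon-vector of $\operatorname{span}(A)$ is $(0,3,6,3)$; that is, the facets of $\operatorname{span}(A)$ are three quadrangles, six pentagons and three hexagons. -/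

import Mathlib

/-! Tropical arithmetic is max-plus: tropical addition is `max`, tropical multiplication is `+`.
The indices `0, 1, 2, 3 : Fin 4` stand for the indices `1, 2, 3, 4` of the text. -/

noncomputable section

namespace TropTet

/-- The maximum of a finite nonempty family of reals is attained at two different indices, at
least. -/
def MaxAttainedTwice {ι : Type*} (f : ι → ℝ) : Prop :=
  ∃ i j, i ≠ j ∧ (∀ k, f k ≤ f i) ∧ (∀ k, f k ≤ f j)

/-- The tropical determinant `max_σ ∑ i, a_{i σ(i)}`. -/
def tropDet {n : ℕ} (A : Matrix (Fin n) (Fin n) ℝ) : ℝ :=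
  Finset.univ.sup' Finset.univ_nonempty (fun σ : Equiv.Perm (Fin n) => ∑ i, A i (σ i))

/-- A square matrix is tropically singular if the maximum in its tropical determinant is attained
twice, at least. -/
def TropSingular {n : ℕ} (A : Matrix (Fin n) (Fin n) ℝ) : Prop :=
  MaxAttainedTwice (fun σ : Equiv.Perm (Fin n) => ∑ i, A i (σ i))

/-- Tropically regular means not tropically singular. -/
def TropRegular {n : ℕ} (A : Matrix (Fin n) (Fin n) ℝ) : Prop := ¬ TropSingular A

/-- The tropical (max-plus) product of two matrices of order 4. -/
def tropMul (A B : Matrix (Fin 4) (Fin 4) ℝ) : Matrix (Fin 4) (Fin 4) ℝ :=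
  fun i j => Finset.univ.sup' Finset.univ_nonempty (fun k => A i k + B k j)

/-- Kleene stars of order 4: zero diagonal and tropically idempotent. -/
def IsKleeneStar (A : Matrix (Fin 4) (Fin 4) ℝ) : Prop :=
  (∀ i, A i i = 0) ∧ tropMul A A = A

/-- The point with homogeneous coordinates `x` lies on the tropical plane in projective tropical
3-space given by the tropical linear form `max_i (a_i + X_i)`. -/
def OnTropPlane (a x : Fin 4 → ℝ) : Prop := MaxAttainedTwice (fun i => a i + x i)

/-- Hypothesis 1: the four columns of `A` are tropically non-coplanar. -/
def Hyp1 (A : Matrix (Fin 4) (Fin 4) ℝ) : Prop :=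
  ¬ ∃ a : Fin 4 → ℝ, ∀ j, OnTropPlane a (fun i => A i j)

/-- Hypothesis 2: every `2 × 2` minor of `A` that involves three or four different indices is
tropically regular. -/
def Hyp2 (A : Matrix (Fin 4) (Fin 4) ℝ) : Prop :=
  ∀ k l i j : Fin 4, k < l → i < j → 3 ≤ ({k, l, i, j} : Finset (Fin 4)).card →
    TropRegular (A.submatrix ![k, l] ![i, j])

/-! ### The chart `X₄ = 0`, and the solid `span(A)` -/

/-- The identification of projective tropical 3-space with `ℝ³`: representatives with last
coordinate `0`. -/
def chart (x : Fin 4 → ℝ) : Fin 3 → ℝ := fun i => x i.castSucc - x 3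

/-- The tropical linear combination of the columns of `A` with coefficients `c`. -/
def tropComb (A : Matrix (Fin 4) (Fin 4) ℝ) (c : Fin 4 → ℝ) : Fin 4 → ℝ :=
  fun i => Finset.univ.sup' Finset.univ_nonempty (fun j => c j + A i j)

/-- The tropical span of the columns of `A`, as a subset of `ℝ³`. -/
def span (A : Matrix (Fin 4) (Fin 4) ℝ) : Set (Fin 3 → ℝ) :=
  Set.range (fun c : Fin 4 → ℝ => chart (tropComb A c))

/-- The generator number `j` of `span(A)`. -/
def generator (A : Matrix (Fin 4) (Fin 4) ℝ) (j : Fin 4) : Fin 3 → ℝ :=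
  chart (fun i => A i j)

/-- The vertex of the tropical plane through the three columns of `B`, by the tropical Cramer rule:
the coefficient of `X_i` in the tropical linear form is the tropical minor omitting row `i`, and the
vertex of the plane with coefficients `a` is `-a`. -/
def planeVertex (B : Matrix (Fin 4) (Fin 3) ℝ) : Fin 4 → ℝ :=
  fun i => - tropDet (B.submatrix i.succAbove id)

/-- The `4 × 3` matrix of the first three columns of `A`. -/
def firstCols (A : Matrix (Fin 4) (Fin 4) ℝ) : Matrix (Fin 4) (Fin 3) ℝ :=
  A.submatrix id Fin.castSucc

/-- The 3-generated extremal `123` of `span(A)`. -/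
def point123 (A : Matrix (Fin 4) (Fin 4) ℝ) : Fin 3 → ℝ := chart (planeVertex (firstCols A))

/-! ### Facets and polygon-vectors -/

/-- A facet of a 3-dimensional convex body: a 2-dimensional exposed face. -/
def IsFacet (S F : Set (Fin 3 → ℝ)) : Prop :=
  IsExposed ℝ S F ∧ Module.finrank ℝ (vectorSpan ℝ F) = 2

/-- For a 2-dimensional `F`: `F` is a convex `m`-gon, that is, it has exactly `m` extreme points and
is their convex hull. -/
def IsGon (m : ℕ) (F : Set (Fin 3 → ℝ)) : Prop :=
  (F.extremePoints ℝ).encard = m ∧ F = convexHull ℝ (F.extremePoints ℝ)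

/-- `S` has polygon-vector `(f₃, f₄, f₅, f₆)`: every facet is a convex `m`-gon with `3 ≤ m ≤ 6`, and
exactly `f_m` facets are `m`-gons, for `m = 3, 4, 5, 6`. -/
def HasPolygonVector (S : Set (Fin 3 → ℝ)) (f₃ f₄ f₅ f₆ : ℕ) : Prop :=
  (∀ F, IsFacet S F → ∃ m, 3 ≤ m ∧ m ≤ 6 ∧ IsGon m F) ∧
  {F | IsFacet S F ∧ IsGon 3 F}.encard = f₃ ∧
  {F | IsFacet S F ∧ IsGon 4 F}.encard = f₄ ∧
  {F | IsFacet S F ∧ IsGon 5 F}.encard = f₅ ∧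
  {F | IsFacet S F ∧ IsGon 6 F}.encard = f₆

/-! ### Configurations (5.5.5), left and right -/

/-- The configuration of `S` at the point `v` is `(5.5.5)`: exactly three facets meet at `v`, and
each of them is a pentagon. -/
def Is555 (S : Set (Fin 3 → ℝ)) (v : Fin 3 → ℝ) : Prop :=
  {F | IsFacet S F ∧ v ∈ F}.encard = 3 ∧ ∀ F, IsFacet S F → v ∈ F → IsGon 5 F

/-- The left model: the columns are the generators `1, 2, 3`, when `123` is the origin. -/
def leftModel (γ δ : Fin 3 → ℝ) : Matrix (Fin 3) (Fin 3) ℝ :=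
  !![0, -γ 1 - δ 1, -γ 2 - γ 1 - δ 1;
     -γ 0 - γ 2 - δ 2, 0, -γ 2 - δ 2;
     -γ 0 - δ 0, -γ 1 - γ 0 - δ 0, 0]

/-- The right model: the columns are the generators `1, 2, 3`, when `123` is the origin. -/
def rightModel (γ δ : Fin 3 → ℝ) : Matrix (Fin 3) (Fin 3) ℝ :=
  !![0, -γ 1 - γ 2 - δ 2, -γ 2 - δ 2;
     -γ 0 - δ 0, 0, -γ 2 - γ 0 - δ 0;
     -γ 0 - γ 1 - δ 1, -γ 1 - δ 1, 0]

/-- After the translation that carries the point `123` to the origin, the generators `1, 2, 3` of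
`span(A)` are the columns of a left model with positive parameters. -/
def FitsLeft (A : Matrix (Fin 4) (Fin 4) ℝ) : Prop :=
  ∃ γ δ : Fin 3 → ℝ, (∀ i, 0 < γ i) ∧ (∀ i, 0 < δ i) ∧
    ∀ i j : Fin 3, generator A j.castSucc i - point123 A i = leftModel γ δ i j

/-- The same for the right model. -/
def FitsRight (A : Matrix (Fin 4) (Fin 4) ℝ) : Prop :=
  ∃ γ δ : Fin 3 → ℝ, (∀ i, 0 < γ i) ∧ (∀ i, 0 < δ i) ∧
    ∀ i j : Fin 3, generator A j.castSucc i - point123 A i = rightModel γ δ i j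

/-- The point `123` of `span(A)` is `(5.5.5)` left. -/
def Left123 (A : Matrix (Fin 4) (Fin 4) ℝ) : Prop :=
  Is555 (span A) (point123 A) ∧ FitsLeft A

/-- The point `123` of `span(A)` is `(5.5.5)` right. -/
def Right123 (A : Matrix (Fin 4) (Fin 4) ℝ) : Prop :=
  Is555 (span A) (point123 A) ∧ FitsRight A

/-- The point `4` of `span(A)` is `(5.5.5)` left. The antipodal map `x ↦ -x` carries `span(A)` onto
`span(Aᵀ)` and the point `4` to the point `123`, and, being a symmetry, it interchanges left and
right. -/
def Left4 (A : Matrix (Fin 4) (Fin 4) ℝ) : Prop :=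
  Is555 (span A) (generator A 3) ∧ FitsRight A.transpose

/-- The point `4` of `span(A)` is `(5.5.5)` right. -/
def Right4 (A : Matrix (Fin 4) (Fin 4) ℝ) : Prop :=
  Is555 (span A) (generator A 3) ∧ FitsLeft A.transpose

/-! ### Types of tropical lines and the type-vector -/

/-- The `2 × 2` tropical minor `m_{ij}` of the `4 × 2` matrix with columns `p, q`. -/
def minor (p q : Fin 4 → ℝ) (i j : Fin 4) : ℝ := tropDet !![p i, q i; p j, q j]

/-- For `{i, j, k, l} = {1, 2, 3, 4}`: the tropical line `L(p, q)` is of type `[ij, kl]`. -/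
def LineHasType (p q : Fin 4 → ℝ) (i j k l : Fin 4) : Prop :=
  minor p q i j + minor p q k l < minor p q i k + minor p q j l ∧
  minor p q i k + minor p q j l = minor p q i l + minor p q j k

/-- The number of lines of type `[ij, kl]` among the six tropical lines through two columns of
`A`. -/
def numLines (A : Matrix (Fin 4) (Fin 4) ℝ) (i j k l : Fin 4) : ℕ :=
  {e : Fin 4 × Fin 4 | e.1 < e.2 ∧
    LineHasType (fun r => A r e.1) (fun r => A r e.2) i j k l}.ncard

/-- The type-vector `(t₁, t₂, t₃)`, where `t_j` is the number of lines of type `[4j, kl]`,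
`{j, k, l} = {1, 2, 3}`. -/
def typeVector (A : Matrix (Fin 4) (Fin 4) ℝ) : ℕ × ℕ × ℕ :=
  (numLines A 3 0 1 2, numLines A 3 1 0 2, numLines A 3 2 0 1)

end TropTet

end

/-!
For a Kleene star `A`, the solid `span A` is the alcoved polytope `A i j ≤ X_i - X_j`
(`IsKleeneStar.span_eq`). Regularity of the minors with three indices makes all triangle inequalities
`A i j + A j k < A i k` strict, so that each of the twelve constraints with `i ≠ j` is tight on a
two-dimensional face with relatively interior points (`IsStrict.exists_mem_face`), and these faces
are exactly the facets (`IsStrict.exists_eq_face_of_isFacet`).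

In the coordinates `X_k - X_j`, `X_l - X_j`, the facet `i, j` is a rectangle, two opposite corners of
which may be cut off by a strip of slope one (`IsStrict.image_face`). A corner is cut off precisely
when the entry `A i j` is on the dominating diagonal of the corresponding `2 × 2` minor with four
different indices; so the facet has `4`, `5` or `6` vertices. By the Krein-Milman theorem it is then a
convex polygon in the required sense. The types of the six tropical lines through two columns are
determined by the signs of the same six minors (`IsStrict.lineHasType_iff`).

Finally, the coordinate conditions on `123` and `4` give three of these six signs each
(`FitsLeft.lt`, `FitsRight.lt`), and the resulting sign pattern is invariant under a cyclic shift of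
the indices `0, 1, 2`: three of the facets `i, j` with `i, j ≤ 2` are hexagons and three are
quadrangles, while the facets through `123` or `4` are pentagons. The case right, right is the case
left, left with the indices `0` and `1` exchanged.
-/

open Set Filter Topology

namespace TropTet

/-! ### Hexagonal regions of the plane -/

/-- The part of the rectangle `[a, b] × [c, d]` that lies in the strip `e ≤ y - x ≤ f`. -/
def cutBox (a b c d e f : ℝ) : Set (ℝ × ℝ) :=
  {p | a ≤ p.1 ∧ p.1 ≤ b ∧ c ≤ p.2 ∧ p.2 ≤ d ∧ e ≤ p.2 - p.1 ∧ p.2 - p.1 ≤ f}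

/-- A point of a plane set at which two independent linear forms are minimal is an extreme point. -/
lemma mem_extremePoints_of_two_forms {Q : Set (ℝ × ℝ)} {x : ℝ × ℝ} (hx : x ∈ Q)
    (g₁ g₂ h₁ h₂ : ℝ) (hg : ∀ y ∈ Q, g₁ * x.1 + g₂ * x.2 ≤ g₁ * y.1 + g₂ * y.2)
    (hh : ∀ y ∈ Q, h₁ * x.1 + h₂ * x.2 ≤ h₁ * y.1 + h₂ * y.2)
    (hdet : g₁ * h₂ - g₂ * h₁ ≠ 0) : x ∈ Q.extremePoints ℝ := by
  refine ⟨hx, fun y hy z hz hseg => ?_⟩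
  obtain ⟨α, β, hα, hβ, hαβ, rfl⟩ := hseg
  have e1 := hg y hy
  have e2 := hg z hz
  have e3 := hh y hy
  have e4 := hh z hz
  simp only [Prod.fst_add, Prod.snd_add, Prod.smul_fst, Prod.smul_snd, smul_eq_mul] at e1 e2 e3 e4
  obtain rfl : α = 1 - β := by linarith
  have k1 : g₁ * (y.1 - z.1) + g₂ * (y.2 - z.2) = 0 := by
    apply le_antisymm
    · have : (1 - β) * (g₁ * (y.1 - z.1) + g₂ * (y.2 - z.2)) ≤ 0 := by linarith
      exact nonpos_of_mul_nonpos_right this hα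
    · have : 0 ≤ β * (g₁ * (y.1 - z.1) + g₂ * (y.2 - z.2)) := by linarith
      exact nonneg_of_mul_nonneg_right this hβ
  have k2 : h₁ * (y.1 - z.1) + h₂ * (y.2 - z.2) = 0 := by
    apply le_antisymm
    · have : (1 - β) * (h₁ * (y.1 - z.1) + h₂ * (y.2 - z.2)) ≤ 0 := by linarith
      exact nonpos_of_mul_nonpos_right this hα
    · have : 0 ≤ β * (h₁ * (y.1 - z.1) + h₂ * (y.2 - z.2)) := by linarith
      exact nonneg_of_mul_nonneg_right this hβ
  have d1 : y.1 - z.1 = 0 := (mul_eq_zero.1 (by linear_combination h₂ * k1 - g₂ * k2 :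
    (g₁ * h₂ - g₂ * h₁) * (y.1 - z.1) = 0)).resolve_left hdet
  have d2 : y.2 - z.2 = 0 := (mul_eq_zero.1 (by linear_combination g₁ * k2 - h₁ * k1 :
    (g₁ * h₂ - g₂ * h₁) * (y.2 - z.2) = 0)).resolve_left hdet
  ext
  · simp only [Prod.fst_add, Prod.smul_fst, smul_eq_mul]; linear_combination β * d1
  · simp only [Prod.snd_add, Prod.smul_snd, smul_eq_mul]; linear_combination β * d2

/-- One cannot move both forward and backward from an extreme point along a nonzero vector. -/
lemma not_both_mem_of_mem_extremePoints {Q : Set (ℝ × ℝ)} {x v : ℝ × ℝ}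
    (hx : x ∈ Q.extremePoints ℝ) (hv : v ≠ 0) (h₁ : x + v ∈ Q) (h₂ : x - v ∈ Q) : False := by
  have := hx.2 h₁ h₂ ⟨1 / 2, 1 / 2, by norm_num, by norm_num, by norm_num, by
    ext <;> simp <;> ring⟩
  exact hv (by simpa using this)

/-- At an extreme point of `cutBox`, a constraint is tight in each of the three directions parallel
to the sides. -/
lemma tight_of_mem_extremePoints_cutBox {a b c d e f : ℝ} {x : ℝ × ℝ}
    (hx : x ∈ (cutBox a b c d e f).extremePoints ℝ) :
    (x.1 = a ∨ x.1 = b ∨ x.2 - x.1 = e ∨ x.2 - x.1 = f) ∧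
    (x.2 = c ∨ x.2 = d ∨ x.2 - x.1 = e ∨ x.2 - x.1 = f) ∧
    (x.1 = a ∨ x.1 = b ∨ x.2 = c ∨ x.2 = d) := by
  obtain ⟨h1, h2, h3, h4, h5, h6⟩ := hx.1
  -- In each direction, a step of the smallest slack keeps the point in the region.
  have step : ∀ s₁ s₂ s₃ s₄ : ℝ, 0 ≤ s₁ → 0 ≤ s₂ → 0 ≤ s₃ → 0 ≤ s₄ → s₁ ≠ 0 → s₂ ≠ 0 → s₃ ≠ 0 →
      s₄ ≠ 0 → ∃ t > 0, t ≤ s₁ ∧ t ≤ s₂ ∧ t ≤ s₃ ∧ t ≤ s₄ := by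
    intro s₁ s₂ s₃ s₄ p1 p2 p3 p4 n1 n2 n3 n4
    refine ⟨min (min s₁ s₂) (min s₃ s₄), ?_, by simp, by simp, by simp, by simp⟩
    exact lt_min (lt_min (p1.lt_of_ne' n1) (p2.lt_of_ne' n2))
      (lt_min (p3.lt_of_ne' n3) (p4.lt_of_ne' n4))
  refine ⟨?_, ?_, ?_⟩
  · by_contra! hne
    obtain ⟨n1, n2, n3, n4⟩ := hne
    obtain ⟨t, ht, t1, t2, t3, t4⟩ := step (x.1 - a) (b - x.1) (x.2 - x.1 - e) (f - (x.2 - x.1))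
      (by linarith) (by linarith) (by linarith) (by linarith) (sub_ne_zero.2 n1)
      (sub_ne_zero.2 n2.symm) (sub_ne_zero.2 n3) (sub_ne_zero.2 n4.symm)
    refine not_both_mem_of_mem_extremePoints (v := (t, 0)) hx (by simp [ht.ne']) ?_ ?_ <;>
      refine ⟨?_, ?_, ?_, ?_, ?_, ?_⟩ <;> simp <;> linarith
  · by_contra! hne
    obtain ⟨n1, n2, n3, n4⟩ := hne
    obtain ⟨t, ht, t1, t2, t3, t4⟩ := step (x.2 - c) (d - x.2) (x.2 - x.1 - e) (f - (x.2 - x.1))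
      (by linarith) (by linarith) (by linarith) (by linarith) (sub_ne_zero.2 n1)
      (sub_ne_zero.2 n2.symm) (sub_ne_zero.2 n3) (sub_ne_zero.2 n4.symm)
    refine not_both_mem_of_mem_extremePoints (v := (0, t)) hx (by simp [ht.ne']) ?_ ?_ <;>
      refine ⟨?_, ?_, ?_, ?_, ?_, ?_⟩ <;> simp <;> linarith
  · by_contra! hne
    obtain ⟨n1, n2, n3, n4⟩ := hne
    obtain ⟨t, ht, t1, t2, t3, t4⟩ := step (x.1 - a) (b - x.1) (x.2 - c) (d - x.2)
      (by linarith) (by linarith) (by linarith) (by linarith) (sub_ne_zero.2 n1)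
      (sub_ne_zero.2 n2.symm) (sub_ne_zero.2 n3) (sub_ne_zero.2 n4.symm)
    refine not_both_mem_of_mem_extremePoints (v := (t, t)) hx (by simp [ht.ne']) ?_ ?_ <;>
      refine ⟨?_, ?_, ?_, ?_, ?_, ?_⟩ <;> simp <;> linarith

section cutBox

variable {a b c d e f : ℝ} (hab : a < b) (hcd : c < d) (h₁ : e < c - a) (h₂ : c - a < f)
  (h₃ : e < d - b) (h₄ : d - b < f)

include hab hcd h₁ h₂ h₃ h₄

/-- The strip cuts off neither of the corners `(a, d)` and `(b, c)`. -/
lemma encard_extremePoints_cutBox_four (hf : d - a < f) (he : e < c - b) :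
    ((cutBox a b c d e f).extremePoints ℝ).encard = 4 := by
  have key : (cutBox a b c d e f).extremePoints ℝ = {(a, c), (b, d), (a, d), (b, c)} := by
    ext x
    constructor
    · intro hx
      obtain ⟨t1, t2, t3⟩ := tight_of_mem_extremePoints_cutBox hx
      obtain ⟨g1, g2, g3, g4, g5, g6⟩ := hx.1
      simp only [mem_insert_iff, mem_singleton_iff, Prod.ext_iff]
      grind
    · rintro (rfl | rfl | rfl | rfl)
      · refine mem_extremePoints_of_two_forms ?_ 1 0 0 1 ?_ ?_ ?_ <;> simp [cutBox] <;> grind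
      · refine mem_extremePoints_of_two_forms ?_ (-1) 0 0 (-1) ?_ ?_ ?_ <;> simp [cutBox] <;> grind
      · refine mem_extremePoints_of_two_forms ?_ 1 0 0 (-1) ?_ ?_ ?_ <;> simp [cutBox] <;> grind
      · refine mem_extremePoints_of_two_forms ?_ (-1) 0 0 1 ?_ ?_ ?_ <;> simp [cutBox] <;> grind
  rw [key]
  repeat rw [encard_insert_of_notMem (by
    simp only [mem_insert_iff, mem_singleton_iff, Prod.ext_iff]; grind)]
  rw [encard_singleton]; norm_num

/-- The strip cuts off the corner `(a, d)` only. -/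
lemma encard_extremePoints_cutBox_five (hf : f < d - a) (he : e < c - b) :
    ((cutBox a b c d e f).extremePoints ℝ).encard = 5 := by
  have key : (cutBox a b c d e f).extremePoints ℝ =
      {(a, c), (b, d), (a, a + f), (d - f, d), (b, c)} := by
    ext x
    constructor
    · intro hx
      obtain ⟨t1, t2, t3⟩ := tight_of_mem_extremePoints_cutBox hx
      obtain ⟨g1, g2, g3, g4, g5, g6⟩ := hx.1
      simp only [mem_insert_iff, mem_singleton_iff, Prod.ext_iff]
      grind
    · rintro (rfl | rfl | rfl | rfl | rfl)
      · refine mem_extremePoints_of_two_forms ?_ 1 0 0 1 ?_ ?_ ?_ <;> simp [cutBox] <;> grind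
      · refine mem_extremePoints_of_two_forms ?_ (-1) 0 0 (-1) ?_ ?_ ?_ <;> simp [cutBox] <;> grind
      · refine mem_extremePoints_of_two_forms ?_ 1 0 1 (-1) ?_ ?_ ?_ <;> simp [cutBox] <;> grind
      · refine mem_extremePoints_of_two_forms ?_ 0 (-1) 1 (-1) ?_ ?_ ?_ <;> simp [cutBox] <;> grind
      · refine mem_extremePoints_of_two_forms ?_ (-1) 0 0 1 ?_ ?_ ?_ <;> simp [cutBox] <;> grind
  rw [key]
  repeat rw [encard_insert_of_notMem (by
    simp only [mem_insert_iff, mem_singleton_iff, Prod.ext_iff]; grind)]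
  rw [encard_singleton]; norm_num

/-- The strip cuts off both of the corners `(a, d)` and `(b, c)`. -/
lemma encard_extremePoints_cutBox_six (hf : f < d - a) (he : c - b < e) :
    ((cutBox a b c d e f).extremePoints ℝ).encard = 6 := by
  have key : (cutBox a b c d e f).extremePoints ℝ =
      {(a, c), (b, d), (a, a + f), (d - f, d), (b, b + e), (c - e, c)} := by
    ext x
    constructor
    · intro hx
      obtain ⟨t1, t2, t3⟩ := tight_of_mem_extremePoints_cutBox hx
      obtain ⟨g1, g2, g3, g4, g5, g6⟩ := hx.1
      simp only [mem_insert_iff, mem_singleton_iff, Prod.ext_iff]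
      grind
    · rintro (rfl | rfl | rfl | rfl | rfl | rfl)
      · refine mem_extremePoints_of_two_forms ?_ 1 0 0 1 ?_ ?_ ?_ <;> simp [cutBox] <;> grind
      · refine mem_extremePoints_of_two_forms ?_ (-1) 0 0 (-1) ?_ ?_ ?_ <;> simp [cutBox] <;> grind
      · refine mem_extremePoints_of_two_forms ?_ 1 0 1 (-1) ?_ ?_ ?_ <;> simp [cutBox] <;> grind
      · refine mem_extremePoints_of_two_forms ?_ 0 (-1) 1 (-1) ?_ ?_ ?_ <;> simp [cutBox] <;> grind
      · refine mem_extremePoints_of_two_forms ?_ (-1) 0 (-1) 1 ?_ ?_ ?_ <;> simp [cutBox] <;> grind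
      · refine mem_extremePoints_of_two_forms ?_ 0 1 (-1) 1 ?_ ?_ ?_ <;> simp [cutBox] <;> grind
  rw [key]
  repeat rw [encard_insert_of_notMem (by
    simp only [mem_insert_iff, mem_singleton_iff, Prod.ext_iff]; grind)]
  rw [encard_singleton]; norm_num

end cutBox

/-- A linear map that is injective on a convex set preserves the number of its extreme points. -/
lemma encard_extremePoints_image {E G : Type*} [AddCommGroup E] [Module ℝ E] [AddCommGroup G]
    [Module ℝ G] (g : E →ₗ[ℝ] G) {S : Set E} (hS : Convex ℝ S) (hg : InjOn g S) :
    ((g '' S).extremePoints ℝ).encard = (S.extremePoints ℝ).encard := by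
  rw [← (hg.mono extremePoints_subset).encard_image]
  congr 1
  ext y
  constructor
  · rintro ⟨⟨x, hx, rfl⟩, h⟩
    refine ⟨x, ⟨hx, fun y hy z hz hseg => ?_⟩, rfl⟩
    refine hg hy hx (h (mem_image_of_mem g hy) (mem_image_of_mem g hz) ?_)
    obtain ⟨α, β, hα, hβ, hαβ, rfl⟩ := hseg
    exact ⟨α, β, hα, hβ, hαβ, by simp⟩
  · rintro ⟨x, ⟨hx, h⟩, rfl⟩
    refine ⟨mem_image_of_mem g hx, ?_⟩
    rintro _ ⟨y, hy, rfl⟩ _ ⟨z, hz, rfl⟩ ⟨α, β, hα, hβ, hαβ, e⟩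
    rw [h hy hz ⟨α, β, hα, hβ, hαβ, hg (hS hy hz hα.le hβ.le hαβ) hx (by simpa using e)⟩]

/-- A compact convex set of `ℝ³` with exactly `m` extreme points is an `m`-gon in the sense of
`IsGon`, by the Krein-Milman theorem. -/
lemma isGon_of_encard {m : ℕ} {F : Set (Fin 3 → ℝ)} (hc : IsCompact F) (hF : Convex ℝ F)
    (h : (F.extremePoints ℝ).encard = m) : IsGon m F := by
  refine ⟨h, ?_⟩
  have hfin := finite_of_encard_eq_coe h
  rw [← (hfin.isClosed_convexHull ℝ).closure_eq, closure_convexHull_extremePoints hc hF]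

/-! ### The span as a polytope -/

/-- The coordinates, with `X₄ = 0`, of the point of projective tropical 3-space that corresponds to
a point of `ℝ³`. -/
def homCoord : (Fin 3 → ℝ) →L[ℝ] (Fin 4 → ℝ) :=
  ContinuousLinearMap.pi
    (Fin.snoc (α := fun _ => (Fin 3 → ℝ) →L[ℝ] ℝ) (fun k => ContinuousLinearMap.proj k) 0)

/-- The linear form `X_i - X_j` on `ℝ³`, where `X₄ = 0`. -/
def gap (i j : Fin 4) : (Fin 3 → ℝ) →L[ℝ] ℝ :=
  (ContinuousLinearMap.proj (R := ℝ) (φ := fun _ : Fin 4 => ℝ) i - ContinuousLinearMap.proj j) ∘L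
    homCoord

lemma gap_apply (i j : Fin 4) (x : Fin 3 → ℝ) : gap i j x = homCoord x i - homCoord x j := rfl

lemma homCoord_castSucc (x : Fin 3 → ℝ) (i : Fin 3) : homCoord x i.castSucc = x i := by
  simp [homCoord]

lemma homCoord_last (x : Fin 3 → ℝ) : homCoord x 3 = 0 := by
  change (Fin.snoc (α := fun _ => (Fin 3 → ℝ) →L[ℝ] ℝ) (fun k => ContinuousLinearMap.proj k) 0
    (Fin.last 3)) x = 0
  rw [Fin.snoc_last]; rfl

lemma homCoord_chart (y : Fin 4 → ℝ) (i : Fin 4) : homCoord (chart y) i = y i - y 3 := by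
  refine Fin.lastCases ?_ (fun k => ?_) i
  · exact (homCoord_last _).trans (sub_self _).symm
  · rw [homCoord_castSucc]; rfl

lemma gap_chart (y : Fin 4 → ℝ) (i j : Fin 4) : gap i j (chart y) = y i - y j := by
  rw [gap_apply, homCoord_chart, homCoord_chart]; ring

lemma gap_castSucc_last (x : Fin 3 → ℝ) (i : Fin 3) : gap i.castSucc 3 x = x i := by
  rw [gap_apply, homCoord_castSucc, homCoord_last, sub_zero]

lemma gap_last_castSucc (x : Fin 3 → ℝ) (i : Fin 3) : gap 3 i.castSucc x = - x i := by
  rw [gap_apply, homCoord_castSucc, homCoord_last, zero_sub]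

lemma chart_homCoord (x : Fin 3 → ℝ) : chart (homCoord x) = x := by
  ext i
  simp [chart, homCoord_castSucc, homCoord_last]

lemma gap_ne_zero {i j : Fin 4} (h : i ≠ j) : (gap i j : (Fin 3 → ℝ) →ₗ[ℝ] ℝ) ≠ 0 := by
  intro h0
  have := LinearMap.congr_fun h0 (chart (Pi.single i 1))
  rw [ContinuousLinearMap.coe_coe, gap_chart] at this
  simp [h.symm] at this

lemma finrank_ker_gap {i j : Fin 4} (h : i ≠ j) :
    Module.finrank ℝ (LinearMap.ker (gap i j : (Fin 3 → ℝ) →ₗ[ℝ] ℝ)) = 2 := by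
  have := Module.Dual.finrank_ker_add_one_of_ne_zero (gap_ne_zero h)
  rw [Module.finrank_fin_fun] at this
  omega

/-- The alcoved polytope with the inequalities `A i j ≤ X_i - X_j`. -/
def polytope (A : Matrix (Fin 4) (Fin 4) ℝ) : Set (Fin 3 → ℝ) := {x | ∀ i j, A i j ≤ gap i j x}

/-- The face of the alcoved polytope on which `X_i - X_j` attains its lower bound `A i j`. -/
def face (A : Matrix (Fin 4) (Fin 4) ℝ) (i j : Fin 4) : Set (Fin 3 → ℝ) :=
  {x ∈ polytope A | gap i j x = A i j}

lemma IsKleeneStar.add_le {A : Matrix (Fin 4) (Fin 4) ℝ} (hA : IsKleeneStar A) (i j k : Fin 4) :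
    A i j + A j k ≤ A i k := by
  conv_rhs => rw [← hA.2]
  exact Finset.le_sup' (fun j => A i j + A j k) (Finset.mem_univ j)

lemma IsKleeneStar.span_eq {A : Matrix (Fin 4) (Fin 4) ℝ} (hA : IsKleeneStar A) :
    span A = polytope A := by
  ext x
  constructor
  · rintro ⟨c, rfl⟩ i j
    rw [gap_chart]
    obtain ⟨k, -, hk⟩ := Finset.exists_mem_eq_sup' Finset.univ_nonempty (fun k => c k + A j k)
    have h : c k + A i k ≤ tropComb A c i :=
      Finset.le_sup' (fun k => c k + A i k) (Finset.mem_univ k)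
    have hj : tropComb A c j = c k + A j k := hk
    linarith [hA.add_le i j k]
  · intro hx
    refine ⟨homCoord x, ?_⟩
    have : tropComb A (homCoord x) = homCoord x := by
      ext i
      refine le_antisymm (Finset.sup'_le _ _ fun j _ => ?_) ?_
      · have := hx i j
        rw [gap_apply] at this
        linarith
      · have := Finset.le_sup' (fun j => homCoord x j + A i j) (Finset.mem_univ i)
        rwa [hA.1 i, add_zero] at this
    simp only [this, chart_homCoord]

lemma convex_polytope (A : Matrix (Fin 4) (Fin 4) ℝ) : Convex ℝ (polytope A) := by
  intro x hx y hy s t hs ht hst i j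
  rw [map_add, map_smul, map_smul, smul_eq_mul, smul_eq_mul]
  calc A i j = s * A i j + t * A i j := by rw [← add_mul, hst, one_mul]
    _ ≤ _ := add_le_add (mul_le_mul_of_nonneg_left (hx i j) hs)
      (mul_le_mul_of_nonneg_left (hy i j) ht)

lemma convex_face (A : Matrix (Fin 4) (Fin 4) ℝ) (i j : Fin 4) : Convex ℝ (face A i j) := by
  intro x hx y hy s t hs ht hst
  refine ⟨convex_polytope A hx.1 hy.1 hs ht hst, ?_⟩
  rw [map_add, map_smul, map_smul, hx.2, hy.2, ← add_smul, hst, one_smul]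

lemma isCompact_face (A : Matrix (Fin 4) (Fin 4) ℝ) (i j : Fin 4) : IsCompact (face A i j) := by
  refine (isCompact_Icc (a := fun k => A k.castSucc 3) (b := fun k => - A 3 k.castSucc)
    ).of_isClosed_subset ?_ ?_
  · have : face A i j = (⋂ k, ⋂ l, {x | A k l ≤ gap k l x}) ∩ {x | gap i j x = A i j} := by
      ext x; simp [face, polytope]
    rw [this]
    exact (isClosed_iInter fun k => isClosed_iInter fun l =>
      isClosed_le continuous_const (gap k l).continuous).inter
        (isClosed_eq (gap i j).continuous continuous_const)
  · intro x hx
    refine ⟨fun k => ?_, fun k => ?_⟩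
    · simpa [gap_castSucc_last] using hx.1 k.castSucc 3
    · have := hx.1 3 k.castSucc
      rw [gap_last_castSucc] at this
      linarith

/-- The two differences of coordinates `X_k - X_j`, `X_l - X_j` determine a point of the face. -/
lemma injOn_face {i j k l : Fin 4} (hij : i ≠ j) (hik : i ≠ k) (hil : i ≠ l) (hjk : j ≠ k)
    (hjl : j ≠ l) (hkl : k ≠ l) :
    InjOn ((gap k j : (Fin 3 → ℝ) →ₗ[ℝ] ℝ).prod (gap l j : (Fin 3 → ℝ) →ₗ[ℝ] ℝ))
      (face A i j) := by
  intro x hx y hy h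
  obtain ⟨h1, h2⟩ := Prod.ext_iff.1 h
  have h1 : gap k j x = gap k j y := h1
  have h2 : gap l j x = gap l j y := h2
  have h3 : gap i j x = gap i j y := hx.2.trans hy.2.symm
  have cases4 : ∀ m, m = i ∨ m = j ∨ m = k ∨ m = l := by
    clear * - hij hik hil hjk hjl hkl
    revert i j k l; decide
  have hall : ∀ m, gap m j x = gap m j y := by
    intro m
    rcases cases4 m with rfl | rfl | rfl | rfl
    · exact h3
    · simp [gap_apply]
    · exact h1
    · exact h2
  ext m
  have e1 := hall m.castSucc
  have e2 := hall 3
  rw [← gap_castSucc_last x, ← gap_castSucc_last y]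
  simp only [gap_apply] at *
  linarith

/-- From a point of the polytope one can move a little along any vector that respects the tight
constraints. -/
lemma eventually_mem_polytope {A : Matrix (Fin 4) (Fin 4) ℝ} {x v : Fin 3 → ℝ}
    (h : ∀ k l, A k l < gap k l x ∨ (A k l ≤ gap k l x ∧ gap k l v = 0)) :
    ∀ᶠ t in 𝓝 (0 : ℝ), x + t • v ∈ polytope A := by
  refine eventually_all.2 fun k => eventually_all.2 fun l => ?_
  rcases h k l with h | ⟨h, h0⟩
  · have hc : Continuous fun t : ℝ => gap k l (x + t • v) := by fun_prop
    have := hc.tendsto 0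
    simp only [zero_smul, add_zero] at this
    exact (this.eventually_const_lt h).mono fun _ => le_of_lt
  · exact Eventually.of_forall fun t => by simpa [h0] using h

/-! ### Strict Kleene stars and the facets -/

/-- Zero diagonal, and strict triangle inequalities: no constraint of the alcoved polytope follows
from the others. -/
structure IsStrict (A : Matrix (Fin 4) (Fin 4) ℝ) : Prop where
  diag : ∀ i, A i i = 0
  add_lt : ∀ i j k, i ≠ j → j ≠ k → A i j + A j k < A i k

/-- A `2 × 2` matrix whose two diagonals have the same sum is tropically singular. -/
lemma tropSingular_of_add_eq {B : Matrix (Fin 2) (Fin 2) ℝ}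
    (h : B 0 0 + B 1 1 = B 0 1 + B 1 0) : TropSingular B := by
  have key : ∀ σ τ : Equiv.Perm (Fin 2), ∑ i, B i (σ i) = ∑ i, B i (τ i) := by
    have : ∀ σ : Equiv.Perm (Fin 2), ∑ i, B i (σ i) = B 0 0 + B 1 1 := by
      intro σ
      have hσ : σ = 1 ∨ σ = Equiv.swap 0 1 := by revert σ; decide
      rcases hσ with rfl | rfl
      · simp
      · simp [h]
    intro σ τ
    rw [this, this]
  exact ⟨1, Equiv.swap 0 1, by decide, fun σ => (key _ _).le, fun σ => (key _ _).le⟩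

/-- The `2 × 2` minor with rows `i, j` and columns `j, k` contains the zero entry `A j j`, so that it
is regular exactly when `A i j + A j k ≠ A i k`. The case `i = k` follows by adding two of the strict
inequalities with three different indices. -/
lemma IsKleeneStar.isStrict {A : Matrix (Fin 4) (Fin 4) ℝ} (hA : IsKleeneStar A) (h2 : Hyp2 A) :
    IsStrict A := by
  have h3 : ∀ i j k, i ≠ j → j ≠ k → i ≠ k → A i j + A j k < A i k := by
    intro i j k hij hjk hik
    refine (hA.add_le i j k).lt_of_ne fun he => ?_
    have hjj := hA.1 j
    have hcard : ∀ i j k : Fin 4, i ≠ j → j ≠ k → i ≠ k →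
        3 ≤ ({i, j, j, k} : Finset (Fin 4)).card ∧ 3 ≤ ({j, i, j, k} : Finset (Fin 4)).card ∧
        3 ≤ ({i, j, k, j} : Finset (Fin 4)).card ∧ 3 ≤ ({j, i, k, j} : Finset (Fin 4)).card := by
      decide
    obtain ⟨c1, c2, c3, c4⟩ := hcard i j k hij hjk hik
    rcases hij.lt_or_gt with h | h <;> rcases hjk.lt_or_gt with h' | h'
    · exact h2 i j j k h h' c1 (tropSingular_of_add_eq (by simp; linarith))
    · exact h2 i j k j h h' c3 (tropSingular_of_add_eq (by simp; linarith))
    · exact h2 j i j k h h' c2 (tropSingular_of_add_eq (by simp; linarith))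
    · exact h2 j i k j h h' c4 (tropSingular_of_add_eq (by simp; linarith))
  refine ⟨hA.1, fun i j k hij hjk => ?_⟩
  rcases eq_or_ne i k with rfl | hik
  · obtain ⟨m, hmi, hmj⟩ : ∃ m : Fin 4, m ≠ i ∧ m ≠ j := by
      clear hij hjk; revert i j; decide
    have e1 := h3 i j m hij hmj.symm hmi.symm
    have e2 := h3 j i m hjk hmi.symm hmj.symm
    rw [hA.1 i]
    linarith
  · exact h3 i j k hij hjk hik

namespace IsStrict

variable {A : Matrix (Fin 4) (Fin 4) ℝ} (hA : IsStrict A)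

include hA

lemma add_le (i j k : Fin 4) : A i j + A j k ≤ A i k := by
  rcases eq_or_ne i j with rfl | hij
  · simp [hA.diag]
  rcases eq_or_ne j k with rfl | hjk
  · simp [hA.diag]
  exact (hA.add_lt i j k hij hjk).le

/-- The midpoint of column `j` of `A` and the negative of row `i` lies in the relative interior of
the face `i, j`. -/
lemma exists_mem_face (i j : Fin 4) :
    ∃ x ∈ face A i j, ∀ k l, k ≠ l → (k, l) ≠ (i, j) → A k l < gap k l x := by
  have hgap : ∀ k l, gap k l (chart fun m => (A m j - A i m) / 2) =
      ((A k j - A l j) + (A i l - A i k)) / 2 := by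
    intro k l; rw [gap_chart]; ring
  refine ⟨chart fun m => (A m j - A i m) / 2, ⟨fun k l => ?_, ?_⟩, fun k l hkl hne => ?_⟩
  · rw [hgap]; linarith [hA.add_le k l j, hA.add_le i k l]
  · rw [hgap, hA.diag, hA.diag]; ring
  · rw [hgap]
    rcases eq_or_ne l j with rfl | hl
    · have hk : i ≠ k := fun h => hne (by rw [h])
      linarith [hA.add_le k l l, hA.add_lt i k l hk hkl]
    · linarith [hA.add_lt k l j hkl hl, hA.add_le i k l]

lemma gap_self (k : Fin 4) (x : Fin 3 → ℝ) : A k k ≤ gap k k x := by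
  rw [hA.diag, gap_apply, sub_self]

lemma vectorSpan_face {i j : Fin 4} :
    vectorSpan ℝ (face A i j) = LinearMap.ker (gap i j : (Fin 3 → ℝ) →ₗ[ℝ] ℝ) := by
  apply le_antisymm
  · rw [vectorSpan_def, Submodule.span_le]
    rintro _ ⟨x, hx, y, hy, rfl⟩
    simp [hx.2, hy.2]
  · intro v hv
    have hv : gap i j v = 0 := hv
    obtain ⟨x, hx, hlt⟩ := hA.exists_mem_face i j
    have hev : ∀ᶠ t in 𝓝 (0 : ℝ), x + t • v ∈ polytope A := by
      refine eventually_mem_polytope fun k l => ?_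
      rcases eq_or_ne k l with rfl | hkl
      · exact Or.inr ⟨hA.gap_self k x, by rw [gap_apply, sub_self]⟩
      by_cases h : (k, l) = (i, j)
      · obtain ⟨rfl, rfl⟩ := Prod.ext_iff.1 h
        exact Or.inr ⟨hx.2.ge, hv⟩
      · exact Or.inl (hlt k l hkl h)
    obtain ⟨t, ht, ht0⟩ := ((hev.filter_mono nhdsWithin_le_nhds).and
      (self_mem_nhdsWithin (s := Ioi (0 : ℝ)))).exists
    have hmem : x + t • v ∈ face A i j := ⟨ht, by simp [hx.2, hv]⟩
    have := vsub_mem_vectorSpan ℝ hmem hx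
    rw [vsub_eq_sub, add_sub_cancel_left] at this
    exact (Submodule.smul_mem_iff _ (ne_of_gt ht0)).1 this

lemma isFacet_face {i j : Fin 4} (hij : i ≠ j) : IsFacet (polytope A) (face A i j) := by
  refine ⟨fun _ => ⟨- gap i j, ?_⟩, by rw [hA.vectorSpan_face, finrank_ker_gap hij]⟩
  obtain ⟨x, hx, -⟩ := hA.exists_mem_face i j
  ext y
  constructor
  · rintro ⟨hy, h⟩
    refine ⟨hy, fun z hz => ?_⟩
    have := hz i j
    simp only [neg_apply]
    linarith
  · rintro ⟨hy, h⟩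
    refine ⟨hy, le_antisymm ?_ (hy i j)⟩
    have := h x hx.1
    simp only [neg_apply, hx.2] at this
    linarith

/-- Every facet of the polytope is one of the faces: a facet on which no constraint is identically
tight would have an interior point of the polytope, so that the linear form exposing it would
vanish. -/
lemma exists_eq_face_of_isFacet {F : Set (Fin 3 → ℝ)} (hF : IsFacet (polytope A) F) :
    ∃ i j, i ≠ j ∧ F = face A i j := by
  obtain ⟨hexp, hdim⟩ := hF
  have hne : F.Nonempty := by
    by_contra h
    rw [not_nonempty_iff_eq_empty.1 h, vectorSpan_empty, finrank_bot] at hdim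
    omega
  have hconv : Convex ℝ F := hexp.convex (convex_polytope A)
  obtain ⟨l, hl⟩ := hexp hne
  have hFP : F ⊆ polytope A := by rw [hl]; exact fun x hx => hx.1
  have hmax : ∀ x ∈ F, ∀ y ∈ polytope A, l y ≤ l x := by
    intro x hx; rw [hl] at hx; exact hx.2
  have hsub : ∃ i j, i ≠ j ∧ F ⊆ face A i j := by
    by_contra! hcon
    have hex : ∀ p : Fin 4 × Fin 4, ∃ y ∈ F, p.1 ≠ p.2 → A p.1 p.2 < gap p.1 p.2 y := by
      intro p
      by_cases hp : p.1 = p.2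
      · exact ⟨hne.some, hne.some_mem, fun h => absurd hp h⟩
      · obtain ⟨y, hy, hyn⟩ := not_subset.1 (hcon p.1 p.2 hp)
        exact ⟨y, hy, fun _ => (hFP hy p.1 p.2).lt_of_ne fun h => hyn ⟨hFP hy, h.symm⟩⟩
    choose y hyF hy using hex
    -- The barycentre of the chosen points violates all tightness conditions simultaneously.
    set z : Fin 3 → ℝ := ∑ p : Fin 4 × Fin 4, (1 / 16 : ℝ) • y p with hz
    have hzF : z ∈ F := hconv.sum_mem (fun _ _ => by norm_num) (by simp) (fun p _ => hyF p)
    have hzlt : ∀ i j, i ≠ j → A i j < gap i j z := by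
      intro i j hij
      have e : A i j = ∑ p : Fin 4 × Fin 4, (1 / 16 : ℝ) * A i j := by simp
      rw [hz, map_sum, e]
      refine Finset.sum_lt_sum (fun p _ => ?_) ⟨(i, j), Finset.mem_univ _, ?_⟩
      · rw [map_smul, smul_eq_mul]
        linarith [hFP (hyF p) i j]
      · rw [map_smul, smul_eq_mul]
        linarith [hy (i, j) hij]
    have hev : ∀ x, (∀ i j, i ≠ j → A i j < gap i j x) → ∀ v,
        ∀ᶠ t in 𝓝 (0 : ℝ), x + t • v ∈ polytope A := by
      intro x hx v
      refine eventually_mem_polytope fun i j => ?_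
      rcases eq_or_ne i j with rfl | hij
      · exact Or.inr ⟨hA.gap_self i x, by rw [gap_apply, sub_self]⟩
      · exact Or.inl (hx i j hij)
    have hl0 : ∀ v, l v ≤ 0 := by
      intro v
      obtain ⟨t, ht, ht0⟩ := (((hev z hzlt v).filter_mono nhdsWithin_le_nhds).and
        (self_mem_nhdsWithin (s := Ioi (0 : ℝ)))).exists
      have := hmax z hzF _ ht
      rw [map_add, map_smul, smul_eq_mul] at this
      exact nonpos_of_mul_nonpos_right (by linarith : t * l v ≤ 0) ht0
    have hl0' : ∀ v, l v = 0 := fun v => le_antisymm (hl0 v) (by simpa using hl0 (-v))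
    have htop : vectorSpan ℝ F = ⊤ := by
      rw [eq_top_iff]
      intro v _
      obtain ⟨t, ht, ht0⟩ := (((hev z hzlt v).filter_mono nhdsWithin_le_nhds).and
        (self_mem_nhdsWithin (s := Ioi (0 : ℝ)))).exists
      have hmem : z + t • v ∈ F := by
        rw [hl]; exact ⟨ht, fun y _ => by rw [hl0', hl0']⟩
      have := vsub_mem_vectorSpan ℝ hmem hzF
      rw [vsub_eq_sub, add_sub_cancel_left] at this
      exact (Submodule.smul_mem_iff _ (ne_of_gt ht0)).1 this
    rw [htop, finrank_top, Module.finrank_fin_fun] at hdim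
    omega
  obtain ⟨i, j, hij, hsub⟩ := hsub
  refine ⟨i, j, hij, hsub.antisymm fun y hy => ?_⟩
  have hspan : vectorSpan ℝ F = vectorSpan ℝ (face A i j) :=
    Submodule.eq_of_le_of_finrank_eq (vectorSpan_mono ℝ hsub)
      (hdim.trans (hA.isFacet_face hij).2.symm)
  obtain ⟨x, hx⟩ := hne
  have hker : vectorSpan ℝ F ≤ LinearMap.ker (l : (Fin 3 → ℝ) →ₗ[ℝ] ℝ) := by
    rw [vectorSpan_def, Submodule.span_le]
    rintro _ ⟨a, ha, b, hb, rfl⟩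
    have : l a = l b := le_antisymm (hmax b hb a (hFP ha)) (hmax a ha b (hFP hb))
    simp [this]
  have hyx : l (y - x) = 0 :=
    hker (hspan ▸ vsub_mem_vectorSpan ℝ hy (hsub hx) : y - x ∈ vectorSpan ℝ F)
  rw [map_sub, sub_eq_zero] at hyx
  rw [hl]
  exact ⟨hy.1, fun w hw => hyx ▸ hmax x hx w hw⟩

lemma face_inj {i j i' j' : Fin 4} (hij' : i' ≠ j') (h : face A i j = face A i' j') :
    i = i' ∧ j = j' := by
  by_contra hne
  obtain ⟨x, hx, hlt⟩ := hA.exists_mem_face i j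
  have hx' : x ∈ face A i' j' := h ▸ hx
  exact (hlt i' j' hij' fun e => hne (by simpa [eq_comm] using e)).ne' hx'.2

/-- In the coordinates `X_k - X_j`, `X_l - X_j`, the face `i, j` is a rectangle cut by a strip. -/
lemma image_face {i j k l : Fin 4} (hij : i ≠ j) (hik : i ≠ k) (hil : i ≠ l) (hjk : j ≠ k)
    (hjl : j ≠ l) (hkl : k ≠ l) :
    ((gap k j : (Fin 3 → ℝ) →ₗ[ℝ] ℝ).prod (gap l j : (Fin 3 → ℝ) →ₗ[ℝ] ℝ)) '' face A i j =
      cutBox (A k j) (A i j - A i k) (A l j) (A i j - A i l) (A l k) (- A k l) := by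
  ext ⟨u, w⟩
  constructor
  · rintro ⟨x, ⟨hx, he⟩, hxe⟩
    obtain ⟨rfl, rfl⟩ := Prod.ext_iff.1 hxe
    have e1 := hx k j
    have e2 := hx i k
    have e3 := hx l j
    have e4 := hx i l
    have e5 := hx l k
    have e6 := hx k l
    simp only [gap_apply] at *
    refine ⟨?_, ?_, ?_, ?_, ?_, ?_⟩ <;> simp [gap_apply] <;> linarith
  · rintro ⟨b1, b2, b3, b4, b5, b6⟩
    simp only at b1 b2 b3 b4 b5 b6
    set X : Fin 4 → ℝ := fun m => if m = i then A i j else if m = k then u else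
      if m = l then w else 0 with hX
    have Xi : X i = A i j := by simp [hX]
    have Xj : X j = 0 := by simp [hX, hij.symm, hjk, hjl]
    have Xk : X k = u := by simp [hX, hik.symm]
    have Xl : X l = w := by simp [hX, hil.symm, hkl.symm]
    have cases4 : ∀ m, m = i ∨ m = j ∨ m = k ∨ m = l := by
      clear * - hij hik hil hjk hjl hkl
      revert i j k l; decide
    refine ⟨chart X, ⟨fun m n => ?_, by rw [gap_chart, Xi, Xj, sub_zero]⟩, ?_⟩
    · rw [gap_chart]
      have d := hA.diag
      have t1 := hA.add_le j i k
      have t2 := hA.add_le j i l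
      have t3 := hA.add_le k i j
      have t4 := hA.add_le l i j
      have t5 := hA.add_le i j k
      have t6 := hA.add_le i j l
      have t7 := hA.add_le k j i
      have t8 := hA.add_le l j i
      have t9 := hA.add_le i j i
      have t10 := hA.add_le i k j
      have t11 := hA.add_le i l j
      rcases cases4 m with h | h | h | h <;> rcases cases4 n with h' | h' | h' | h' <;>
        simp only [h, h', Xi, Xj, Xk, Xl] <;> linarith [d i, d j, d k, d l]
    · simp [gap_chart, Xj, Xk, Xl]

/-- By `image_face`, the extreme points of a face can be counted in the plane. -/
lemma isGon_face {m : ℕ} {i j k l : Fin 4} (hij : i ≠ j) (hik : i ≠ k) (hil : i ≠ l) (hjk : j ≠ k)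
    (hjl : j ≠ l) (hkl : k ≠ l)
    (h : ((cutBox (A k j) (A i j - A i k) (A l j) (A i j - A i l) (A l k) (- A k l)).extremePoints
      ℝ).encard = m) : IsGon m (face A i j) := by
  refine isGon_of_encard (isCompact_face A i j) (convex_face A i j) ?_
  rw [← h, ← hA.image_face hij hik hil hjk hjl hkl,
    encard_extremePoints_image _ (convex_face A i j) (injOn_face hij hik hil hjk hjl hkl)]

/-- The bounds of the rectangle and of the strip in `image_face` are in general position. -/
lemma cutBox_bounds {i j k l : Fin 4} (hik : i ≠ k) (hil : i ≠ l) (hjk : j ≠ k)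
    (hjl : j ≠ l) (hkl : k ≠ l) :
    A k j < A i j - A i k ∧ A l j < A i j - A i l ∧ A l k < A l j - A k j ∧
      A l j - A k j < - A k l ∧ A l k < (A i j - A i l) - (A i j - A i k) ∧
      (A i j - A i l) - (A i j - A i k) < - A k l := by
  have e1 := hA.add_lt i k j hik hjk.symm
  have e2 := hA.add_lt i l j hil hjl.symm
  have e3 := hA.add_lt l k j hkl.symm hjk.symm
  have e4 := hA.add_lt k l j hkl hjl.symm
  have e5 := hA.add_lt i l k hil hkl.symm
  have e6 := hA.add_lt i k l hik hkl
  refine ⟨?_, ?_, ?_, ?_, ?_, ?_⟩ <;> linarith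

/-- A face has four vertices when the entry `i, j` is on the dominated diagonal of both minors with
four different indices that contain it: no corner of the rectangle is cut off then. -/
lemma isGon_four {i j k l : Fin 4} (hij : i ≠ j) (hik : i ≠ k) (hil : i ≠ l) (hjk : j ≠ k)
    (hjl : j ≠ l) (hkl : k ≠ l) (h₁ : A i j + A k l < A i l + A k j)
    (h₂ : A i j + A l k < A i k + A l j) : IsGon 4 (face A i j) := by
  obtain ⟨b1, b2, b3, b4, b5, b6⟩ := hA.cutBox_bounds (i := i) (j := j) hik hil hjk hjl hkl
  exact hA.isGon_face hij hik hil hjk hjl hkl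
    (encard_extremePoints_cutBox_four b1 b2 b3 b4 b5 b6 (by linarith) (by linarith))

/-- Each of the two minors in which the entry `i, j` is on the dominating diagonal cuts off one corner
of the rectangle, and so adds one vertex. -/
lemma isGon_five {i j k l : Fin 4} (hij : i ≠ j) (hik : i ≠ k) (hil : i ≠ l) (hjk : j ≠ k)
    (hjl : j ≠ l) (hkl : k ≠ l) (h₁ : A i l + A k j < A i j + A k l)
    (h₂ : A i j + A l k < A i k + A l j) : IsGon 5 (face A i j) := by
  obtain ⟨b1, b2, b3, b4, b5, b6⟩ := hA.cutBox_bounds (i := i) (j := j) hik hil hjk hjl hkl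
  exact hA.isGon_face hij hik hil hjk hjl hkl
    (encard_extremePoints_cutBox_five b1 b2 b3 b4 b5 b6 (by linarith) (by linarith))

lemma isGon_six {i j k l : Fin 4} (hij : i ≠ j) (hik : i ≠ k) (hil : i ≠ l) (hjk : j ≠ k)
    (hjl : j ≠ l) (hkl : k ≠ l) (h₁ : A i l + A k j < A i j + A k l)
    (h₂ : A i k + A l j < A i j + A l k) : IsGon 6 (face A i j) := by
  obtain ⟨b1, b2, b3, b4, b5, b6⟩ := hA.cutBox_bounds (i := i) (j := j) hik hil hjk hjl hkl
  exact hA.isGon_face hij hik hil hjk hjl hkl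
    (encard_extremePoints_cutBox_six b1 b2 b3 b4 b5 b6 (by linarith) (by linarith))

end IsStrict

/-! ### Sign patterns of the six four-index minors -/

/-- The signs of the six `2 × 2` minors of `A` with four different indices, up to the relabelling
`σ`: each inequality says which diagonal dominates, and all of them are invariant under the cyclic
shift of the indices `0, 1, 2`. The identity gives the pattern of the case left, left. -/
structure IsCyclic (A : Matrix (Fin 4) (Fin 4) ℝ) (σ : Equiv.Perm (Fin 4)) : Prop where
  row₀ : A (σ 0) (σ 2) + A (σ 3) (σ 1) < A (σ 0) (σ 1) + A (σ 3) (σ 2)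
  row₁ : A (σ 1) (σ 0) + A (σ 3) (σ 2) < A (σ 1) (σ 2) + A (σ 3) (σ 0)
  row₂ : A (σ 2) (σ 1) + A (σ 3) (σ 0) < A (σ 2) (σ 0) + A (σ 3) (σ 1)
  col₀ : A (σ 1) (σ 0) + A (σ 2) (σ 3) < A (σ 2) (σ 0) + A (σ 1) (σ 3)
  col₁ : A (σ 2) (σ 1) + A (σ 0) (σ 3) < A (σ 0) (σ 1) + A (σ 2) (σ 3)
  col₂ : A (σ 0) (σ 2) + A (σ 1) (σ 3) < A (σ 1) (σ 2) + A (σ 0) (σ 3)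

/-- In each row of the left model the two off-diagonal entries differ by one of the `γ i`. When the
coordinates of two generators are subtracted, the point `123` cancels, so its value is not needed. -/
lemma FitsLeft.lt {A : Matrix (Fin 4) (Fin 4) ℝ} (h : FitsLeft A) :
    A 0 2 + A 3 1 < A 0 1 + A 3 2 ∧ A 1 0 + A 3 2 < A 1 2 + A 3 0 ∧
      A 2 1 + A 3 0 < A 2 0 + A 3 1 := by
  obtain ⟨γ, δ, hγ, hδ, h⟩ := h
  have e01 := h 0 1
  have e02 := h 0 2
  have e10 := h 1 0
  have e12 := h 1 2
  have e20 := h 2 0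
  have e21 := h 2 1
  simp [generator, chart, leftModel] at e01 e02 e10 e12 e20 e21
  refine ⟨?_, ?_, ?_⟩ <;> linarith [hγ 0, hγ 1, hγ 2]

lemma FitsRight.lt {A : Matrix (Fin 4) (Fin 4) ℝ} (h : FitsRight A) :
    A 0 1 + A 3 2 < A 0 2 + A 3 1 ∧ A 1 2 + A 3 0 < A 1 0 + A 3 2 ∧
      A 2 0 + A 3 1 < A 2 1 + A 3 0 := by
  obtain ⟨γ, δ, hγ, hδ, h⟩ := h
  have e01 := h 0 1
  have e02 := h 0 2
  have e10 := h 1 0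
  have e12 := h 1 2
  have e20 := h 2 0
  have e21 := h 2 1
  simp [generator, chart, rightModel] at e01 e02 e10 e12 e20 e21
  refine ⟨?_, ?_, ?_⟩ <;> linarith [hγ 0, hγ 1, hγ 2]

lemma isCyclic_of_left {A : Matrix (Fin 4) (Fin 4) ℝ} (h : FitsLeft A)
    (ht : FitsRight A.transpose) : IsCyclic A 1 := by
  obtain ⟨a0, a1, a2⟩ := h.lt
  obtain ⟨b0, b1, b2⟩ := ht.lt
  simp only [Matrix.transpose_apply] at b0 b1 b2
  refine ⟨?_, ?_, ?_, ?_, ?_, ?_⟩ <;> simp only [Equiv.Perm.coe_one, id_eq] <;> linarith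

lemma isCyclic_of_right {A : Matrix (Fin 4) (Fin 4) ℝ} (h : FitsRight A)
    (ht : FitsLeft A.transpose) : IsCyclic A (Equiv.swap 0 1) := by
  obtain ⟨a0, a1, a2⟩ := h.lt
  obtain ⟨b0, b1, b2⟩ := ht.lt
  simp only [Matrix.transpose_apply] at b0 b1 b2
  have s0 : Equiv.swap (0 : Fin 4) 1 0 = 1 := by decide
  have s1 : Equiv.swap (0 : Fin 4) 1 1 = 0 := by decide
  have s2 : Equiv.swap (0 : Fin 4) 1 2 = 2 := by decide
  have s3 : Equiv.swap (0 : Fin 4) 1 3 = 3 := by decide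
  refine ⟨?_, ?_, ?_, ?_, ?_, ?_⟩ <;> simp only [s0, s1, s2, s3] <;> linarith

/-! ### The polygon-vector -/

/-- The number of vertices of the face `a, b` in the pattern `IsCyclic`: four, plus the number of
minors with four different indices in which the entry `a, b` is on the dominating diagonal. The
values at `a = b` are irrelevant. -/
def gonNumber (a b : Fin 4) : ℕ := !![0, 6, 4, 5; 4, 0, 6, 5; 6, 4, 0, 5; 5, 5, 5, 0] a b

/-- The vertex numbers of the twelve facets; in the pentagons, `k` and `l` are ordered so that
`A i j + A k l` is the dominating diagonal. -/
lemma IsCyclic.isGon {A : Matrix (Fin 4) (Fin 4) ℝ} {σ : Equiv.Perm (Fin 4)} (h : IsCyclic A σ)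
    (hA : IsStrict A) {a b : Fin 4} (hab : a ≠ b) :
    IsGon (gonNumber a b) (face A (σ a) (σ b)) := by
  have n : ∀ {x y : Fin 4}, x ≠ y → σ x ≠ σ y := fun hxy => σ.injective.ne hxy
  obtain ⟨r0, r1, r2, c0, c1, c2⟩ := h
  have g01 : IsGon 6 (face A (σ 0) (σ 1)) := hA.isGon_six (k := σ 2) (l := σ 3)
    (n (by decide)) (n (by decide)) (n (by decide)) (n (by decide)) (n (by decide)) (n (by decide))
    (by linarith) (by linarith)
  have g12 : IsGon 6 (face A (σ 1) (σ 2)) := hA.isGon_six (k := σ 0) (l := σ 3)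
    (n (by decide)) (n (by decide)) (n (by decide)) (n (by decide)) (n (by decide)) (n (by decide))
    (by linarith) (by linarith)
  have g20 : IsGon 6 (face A (σ 2) (σ 0)) := hA.isGon_six (k := σ 1) (l := σ 3)
    (n (by decide)) (n (by decide)) (n (by decide)) (n (by decide)) (n (by decide)) (n (by decide))
    (by linarith) (by linarith)
  have g10 : IsGon 4 (face A (σ 1) (σ 0)) := hA.isGon_four (k := σ 2) (l := σ 3)
    (n (by decide)) (n (by decide)) (n (by decide)) (n (by decide)) (n (by decide)) (n (by decide))
    (by linarith) (by linarith)
  have g21 : IsGon 4 (face A (σ 2) (σ 1)) := hA.isGon_four (k := σ 0) (l := σ 3)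
    (n (by decide)) (n (by decide)) (n (by decide)) (n (by decide)) (n (by decide)) (n (by decide))
    (by linarith) (by linarith)
  have g02 : IsGon 4 (face A (σ 0) (σ 2)) := hA.isGon_four (k := σ 1) (l := σ 3)
    (n (by decide)) (n (by decide)) (n (by decide)) (n (by decide)) (n (by decide)) (n (by decide))
    (by linarith) (by linarith)
  have g30 : IsGon 5 (face A (σ 3) (σ 0)) := hA.isGon_five (k := σ 1) (l := σ 2)
    (n (by decide)) (n (by decide)) (n (by decide)) (n (by decide)) (n (by decide)) (n (by decide))
    (by linarith) (by linarith)
  have g31 : IsGon 5 (face A (σ 3) (σ 1)) := hA.isGon_five (k := σ 2) (l := σ 0)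
    (n (by decide)) (n (by decide)) (n (by decide)) (n (by decide)) (n (by decide)) (n (by decide))
    (by linarith) (by linarith)
  have g32 : IsGon 5 (face A (σ 3) (σ 2)) := hA.isGon_five (k := σ 0) (l := σ 1)
    (n (by decide)) (n (by decide)) (n (by decide)) (n (by decide)) (n (by decide)) (n (by decide))
    (by linarith) (by linarith)
  have g03 : IsGon 5 (face A (σ 0) (σ 3)) := hA.isGon_five (k := σ 1) (l := σ 2)
    (n (by decide)) (n (by decide)) (n (by decide)) (n (by decide)) (n (by decide)) (n (by decide))
    (by linarith) (by linarith)
  have g13 : IsGon 5 (face A (σ 1) (σ 3)) := hA.isGon_five (k := σ 2) (l := σ 0)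
    (n (by decide)) (n (by decide)) (n (by decide)) (n (by decide)) (n (by decide)) (n (by decide))
    (by linarith) (by linarith)
  have g23 : IsGon 5 (face A (σ 2) (σ 3)) := hA.isGon_five (k := σ 0) (l := σ 1)
    (n (by decide)) (n (by decide)) (n (by decide)) (n (by decide)) (n (by decide)) (n (by decide))
    (by linarith) (by linarith)
  fin_cases a <;> fin_cases b <;>
    first | exact absurd rfl hab | assumption

lemma IsGon.unique {m n : ℕ} {F : Set (Fin 3 → ℝ)} (hm : IsGon m F) (hn : IsGon n F) : m = n := by
  have := hm.1.symm.trans hn.1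
  exact_mod_cast this

/-- The facets are the faces `i, j` with `i ≠ j`, pairwise distinct, so that counting `m`-gons is
counting entries of the table `gonNumber`. -/
lemma IsCyclic.encard_gons {A : Matrix (Fin 4) (Fin 4) ℝ} {σ : Equiv.Perm (Fin 4)}
    (h : IsCyclic A σ) (hA : IsStrict A) (m : ℕ) :
    {F | IsFacet (polytope A) F ∧ IsGon m F}.encard =
      (Finset.univ.filter fun p : Fin 4 × Fin 4 =>
        p.1 ≠ p.2 ∧ gonNumber p.1 p.2 = m).card := by
  set S : Finset (Fin 4 × Fin 4) :=
    Finset.univ.filter fun p => p.1 ≠ p.2 ∧ gonNumber p.1 p.2 = m with hS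
  have mem_S : ∀ p, p ∈ S ↔ p.1 ≠ p.2 ∧ gonNumber p.1 p.2 = m := by simp [hS]
  have hinj : InjOn (fun p : Fin 4 × Fin 4 => face A (σ p.1) (σ p.2))
      (S : Set (Fin 4 × Fin 4)) := by
    intro p hp q hq hpq
    have hne := ((mem_S q).1 (Finset.mem_coe.1 hq)).1
    obtain ⟨e₁, e₂⟩ := hA.face_inj (σ.injective.ne hne) hpq
    exact Prod.ext (σ.injective e₁) (σ.injective e₂)
  have himage : {F | IsFacet (polytope A) F ∧ IsGon m F} =
      (fun p : Fin 4 × Fin 4 => face A (σ p.1) (σ p.2)) '' (S : Set (Fin 4 × Fin 4)) := by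
    ext F
    constructor
    · rintro ⟨hF, hm⟩
      obtain ⟨i, j, hij, rfl⟩ := hA.exists_eq_face_of_isFacet hF
      obtain ⟨a, rfl⟩ := σ.surjective i
      obtain ⟨b, rfl⟩ := σ.surjective j
      have hab : a ≠ b := fun e => hij (by rw [e])
      exact ⟨(a, b), Finset.mem_coe.2 <| (mem_S _).2 ⟨hab, (h.isGon hA hab).unique hm⟩, rfl⟩
    · rintro ⟨⟨a, b⟩, hp, rfl⟩
      obtain ⟨hab, rfl⟩ := (mem_S _).1 (Finset.mem_coe.1 hp)
      exact ⟨hA.isFacet_face (σ.injective.ne hab), h.isGon hA hab⟩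
  rw [himage, hinj.encard_image, Set.encard_coe_eq_coe_finsetCard]

lemma IsCyclic.hasPolygonVector {A : Matrix (Fin 4) (Fin 4) ℝ} {σ : Equiv.Perm (Fin 4)}
    (h : IsCyclic A σ) (hA : IsStrict A) : HasPolygonVector (polytope A) 0 3 6 3 := by
  refine ⟨fun F hF => ?_, ?_, ?_, ?_, ?_⟩
  · obtain ⟨i, j, hij, rfl⟩ := hA.exists_eq_face_of_isFacet hF
    obtain ⟨a, rfl⟩ := σ.surjective i
    obtain ⟨b, rfl⟩ := σ.surjective j
    have hab : a ≠ b := fun e => hij (by rw [e])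
    have hdeg : ∀ a b : Fin 4, a ≠ b → 3 ≤ gonNumber a b ∧ gonNumber a b ≤ 6 := by decide
    exact ⟨gonNumber a b, (hdeg a b hab).1, (hdeg a b hab).2, h.isGon hA hab⟩
  all_goals
    rw [h.encard_gons hA]
    congr 1

/-! ### The type-vector -/

lemma minor_eq (p q : Fin 4 → ℝ) (i j : Fin 4) :
    minor p q i j = max (p i + q j) (q i + p j) := by
  have hu : (Finset.univ : Finset (Equiv.Perm (Fin 2))) = {1, Equiv.swap 0 1} := by decide
  simp [minor, tropDet, hu]

/-- For `{a, b, k, l} = {0, 1, 2, 3}`, the line through the columns `a` and `b` is of type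
`[ak, bl]` when the diagonal of `A k a` and `A l b` dominates, and of no other type. -/
lemma IsStrict.lineHasType_iff {A : Matrix (Fin 4) (Fin 4) ℝ} (hA : IsStrict A) {a b k l : Fin 4}
    (hd : [a, b, k, l].Nodup) (h : A l a + A k b < A k a + A l b) {i j m n : Fin 4}
    (hd' : [i, j, m, n].Nodup) :
    LineHasType (fun r => A r a) (fun r => A r b) i j m n ↔
      (i = a ∧ j = k) ∨ (i = k ∧ j = a) ∨ (i = b ∧ j = l) ∨ (i = l ∧ j = b) := by
  have cases4 : ∀ x, x = a ∨ x = b ∨ x = k ∨ x = l := by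
    clear h hd'
    revert a b k l; decide
  simp only [List.nodup_cons, List.mem_cons, List.not_mem_nil, not_or, or_false,
    ← ne_eq] at hd hd'
  obtain ⟨⟨nab, nak, nal⟩, ⟨nbk, nbl⟩, nkl, -⟩ := hd
  obtain ⟨⟨nij, nim, nin⟩, ⟨njm, njn⟩, nmn, -⟩ := hd'
  have M : ∀ x y, minor (fun r => A r a) (fun r => A r b) x y =
      max (A x a + A y b) (A x b + A y a) := fun x y => minor_eq _ _ x y
  have comm : ∀ x y, minor (fun r => A r a) (fun r => A r b) x y =
      minor (fun r => A r a) (fun r => A r b) y x := by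
    intro x y
    rw [M, M, max_comm, add_comm (A x b), add_comm (A x a)]
  have mab : minor (fun r => A r a) (fun r => A r b) a b = 0 := by
    rw [M, hA.diag, hA.diag, add_zero]
    exact max_eq_left (by linarith [hA.add_lt a b a nab nab.symm, hA.diag a])
  have mak : minor (fun r => A r a) (fun r => A r b) a k = A k b := by
    rw [M, hA.diag, zero_add]
    exact max_eq_left (by linarith [hA.add_lt k a b nak.symm nab])
  have mal : minor (fun r => A r a) (fun r => A r b) a l = A l b := by
    rw [M, hA.diag, zero_add]
    exact max_eq_left (by linarith [hA.add_lt l a b nal.symm nab])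
  have mbk : minor (fun r => A r a) (fun r => A r b) b k = A k a := by
    rw [M, hA.diag, zero_add]
    exact max_eq_right (by linarith [hA.add_lt k b a nbk.symm nab.symm])
  have mbl : minor (fun r => A r a) (fun r => A r b) b l = A l a := by
    rw [M, hA.diag, zero_add]
    exact max_eq_right (by linarith [hA.add_lt l b a nbl.symm nab.symm])
  have mkl : minor (fun r => A r a) (fun r => A r b) k l = A k a + A l b := by
    rw [M]
    exact max_eq_left (by linarith)
  have mba := (comm b a).trans mab
  have mka := (comm k a).trans mak
  have mla := (comm l a).trans mal
  have mkb := (comm k b).trans mbk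
  have mlb := (comm l b).trans mbl
  have mlk := (comm l k).trans mkl
  unfold LineHasType
  rcases cases4 i with hi | hi | hi | hi <;> rcases cases4 j with hj | hj | hj | hj <;>
    first
    | exact absurd (hi.trans hj.symm) nij
    | (rcases cases4 m with hm | hm | hm | hm <;>
        first
        | exact absurd (hi.trans hm.symm) nim
        | exact absurd (hj.trans hm.symm) njm
        | (rcases cases4 n with hn | hn | hn | hn <;>
            first
            | exact absurd (hi.trans hn.symm) nin
            | exact absurd (hj.trans hn.symm) njn
            | exact absurd (hm.trans hn.symm) nmn
            | (rw [hi, hj, hm, hn]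
               simp only [mab, mak, mal, mbk, mbl, mkl, mba, mka, mla, mkb, mlb, mlk]
               first
               | exact iff_of_true ⟨by linarith, by linarith⟩ (by simp)
               | exact iff_of_false (fun H => by linarith [H.1, H.2]) (by
                   simp [nab, nak, nal, nbk, nbl, nkl, nab.symm, nak.symm, nal.symm, nbk.symm,
                     nbl.symm, nkl.symm]))))

/-- If the line through the columns `a < b` is of type `[ak, bl]` with `k = κ a b` and `l = μ a b`,
then the numbers of lines of each type can be read off from `κ` and `μ`. -/
lemma IsStrict.numLines_eq_card {A : Matrix (Fin 4) (Fin 4) ℝ} (hA : IsStrict A)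
    (κ μ : Matrix (Fin 4) (Fin 4) (Fin 4)) (hd : ∀ a b, a < b → [a, b, κ a b, μ a b].Nodup)
    (h : ∀ a b, a < b → A (μ a b) a + A (κ a b) b < A (κ a b) a + A (μ a b) b)
    {i j m n : Fin 4} (hd' : [i, j, m, n].Nodup) :
    numLines A i j m n = (Finset.univ.filter fun e : Fin 4 × Fin 4 => e.1 < e.2 ∧
      ((i = e.1 ∧ j = κ e.1 e.2) ∨ (i = κ e.1 e.2 ∧ j = e.1) ∨
        (i = e.2 ∧ j = μ e.1 e.2) ∨ (i = μ e.1 e.2 ∧ j = e.2))).card := by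
  rw [← Set.ncard_coe_finset, numLines]
  congr 1
  ext ⟨a, b⟩
  simp only [mem_ofPred_eq, Finset.coe_filter, Finset.mem_univ, true_and]
  exact and_congr_right fun hab => hA.lineHasType_iff (hd a b hab) (h a b hab) hd'

lemma IsCyclic.typeVector_one {A : Matrix (Fin 4) (Fin 4) ℝ} (h : IsCyclic A 1)
    (hA : IsStrict A) : typeVector A = (2, 2, 2) := by
  obtain ⟨r0, r1, r2, c0, c1, c2⟩ := h
  simp only [Equiv.Perm.coe_one, id_eq] at r0 r1 r2 c0 c1 c2
  have h01 : A 3 0 + A 2 1 < A 2 0 + A 3 1 := by linarith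
  have h02 : A 1 0 + A 3 2 < A 3 0 + A 1 2 := by linarith
  have h12 : A 3 1 + A 0 2 < A 0 1 + A 3 2 := by linarith
  have h03 : A 1 0 + A 2 3 < A 2 0 + A 1 3 := by linarith
  have h13 : A 2 1 + A 0 3 < A 0 1 + A 2 3 := by linarith
  have h23 : A 0 2 + A 1 3 < A 1 2 + A 0 3 := by linarith
  -- Only the entries above the diagonals of the two tables are used.
  have key := fun i j m n => hA.numLines_eq_card (i := i) (j := j) (m := m) (n := n)
    !![0, 2, 3, 2; 0, 0, 0, 0; 0, 0, 0, 1; 0, 0, 0, 0]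
    !![0, 3, 1, 1; 0, 0, 3, 2; 0, 0, 0, 0; 0, 0, 0, 0] (by decide) (by
      intro a b hab
      fin_cases a <;> fin_cases b <;> first | exact absurd hab (by decide) | assumption)
  rw [typeVector, key _ _ _ _ (by decide), key _ _ _ _ (by decide), key _ _ _ _ (by decide)]
  decide

lemma IsCyclic.typeVector_swap {A : Matrix (Fin 4) (Fin 4) ℝ} (h : IsCyclic A (Equiv.swap 0 1))
    (hA : IsStrict A) : typeVector A = (2, 2, 2) := by
  obtain ⟨r0, r1, r2, c0, c1, c2⟩ := h
  have s0 : Equiv.swap (0 : Fin 4) 1 0 = 1 := by decide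
  have s1 : Equiv.swap (0 : Fin 4) 1 1 = 0 := by decide
  have s2 : Equiv.swap (0 : Fin 4) 1 2 = 2 := by decide
  have s3 : Equiv.swap (0 : Fin 4) 1 3 = 3 := by decide
  simp only [s0, s1, s2, s3] at r0 r1 r2 c0 c1 c2
  have h01 : A 2 0 + A 3 1 < A 3 0 + A 2 1 := by linarith
  have h02 : A 3 0 + A 1 2 < A 1 0 + A 3 2 := by linarith
  have h12 : A 0 1 + A 3 2 < A 3 1 + A 0 2 := by linarith
  have h03 : A 2 0 + A 1 3 < A 1 0 + A 2 3 := by linarith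
  have h13 : A 0 1 + A 2 3 < A 2 1 + A 0 3 := by linarith
  have h23 : A 1 2 + A 0 3 < A 0 2 + A 1 3 := by linarith
  -- The tables of `typeVector_one` exchange their roles, since all minors change sign.
  have key := fun i j m n => hA.numLines_eq_card (i := i) (j := j) (m := m) (n := n)
    !![0, 3, 1, 1; 0, 0, 3, 2; 0, 0, 0, 0; 0, 0, 0, 0]
    !![0, 2, 3, 2; 0, 0, 0, 0; 0, 0, 0, 1; 0, 0, 0, 0] (by decide) (by
      intro a b hab
      fin_cases a <;> fin_cases b <;> first | exact absurd hab (by decide) | assumption)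
  rw [typeVector, key _ _ _ _ (by decide), key _ _ _ _ (by decide), key _ _ _ _ (by decide)]
  decide

end TropTet

theorem mainTheorem4 (A : Matrix (Fin 4) (Fin 4) ℝ)
    (hA : TropTet.IsKleeneStar A) (h1 : TropTet.Hyp1 A) (h2 : TropTet.Hyp2 A)
    (h : (TropTet.Left123 A ∧ TropTet.Left4 A) ∨ (TropTet.Right123 A ∧ TropTet.Right4 A)) :
    TropTet.typeVector A = (2, 2, 2) ∧
      TropTet.HasPolygonVector (TropTet.span A) 0 3 6 3 := by
  have hs := hA.isStrict h2
  rw [hA.span_eq]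
  rcases h with ⟨h, h'⟩ | ⟨h, h'⟩
  · have hc := TropTet.isCyclic_of_left h.2 h'.2
    exact ⟨hc.typeVector_one hs, hc.hasPolygonVector hs⟩
  · have hc := TropTet.isCyclic_of_right h.2 h'.2
    exact ⟨hc.typeVector_swap hs, hc.hasPolygonVector hs⟩
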